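/- Let $\mathcal J$ be a finite set of jobs and $\mathcal M$ a finite set of machines, and let $p_{ij}\in[0,\infty]$ be the processing time of job $j$ on machine $i$. A solution is a function $\sigma:\mathcal J\to\mathcal M$; its makespan is $\max_{i\in\mathcal M}\sum_{j\in\sigma^{-1}(i)}p_{ij}$, and $\mathrm{OPT}$ is the minimum makespan of a solution. The instance is an instance of Restricted Assignment if for every job $j$ there is a finite $p_j\ge 0$ with $p_{ij}\in\{p_j,\infty\}$ for all $i\in\mathcal M$. For $T\ge 0$ let $\mathcal C_i(T)=\{C\subseteq\mathcal J:\sum_{j\in C}p_{ij}\le T\}$. The configuration-LP for makespan $T$ asks for real numbers $x_{i,C}\ge 0$ ($i\in\mathcal M$, $C\in\mathcal C_i(T)$) such that $$\sum_{C\in\mathcal C_i(T)}x_{i,C}\le 1\quad\forall i\in\mathcal M,\qquad \sum_{i\in\mathcal M}\ \sum_{C\in\mathcal C_i(T):\,j\in C}x_{i,C}\ge 1\quad\forall j\in\mathcal J .$$ Let $\mathrm{OPT}^*$ be the least $T$ for which the configuration-LP is feasible ($\infty$ if there is none). The integrality gap of the configuration-LP is the supremum of $\mathrm{OPT}/\mathrm{OPT}^*$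 over all instances of Restricted Assignment (where the quotient is $0$ if $\mathrm{OPT}=\mathrm{OPT}^*=0$ or if $\mathrm{OPT}^*=\infty$, and $\infty$ if $\mathrm{OPT}^*=0<\mathrm{OPT}$ or $\mathrm{OPT}^*<\infty=\mathrm{OPT}$). **Theorem.** The configuration-LP for Restricted Assignment has integrality gap at most $2-\frac16=\frac{11}{6}$. Moreover, for every instance of Restricted Assignment and every $T\ge 0$ for which the configuration-LP is feasible, there is a solution $\sigma:\mathcal J\to\mathcal M$ with makespan at most $\frac{11}{6}\,T$. -/

import Mathlib

open scoped NNReal ENNReal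

universe u v

namespace Scheduling

/-- An instance of scheduling on unrelated machines with machines `M` and jobs `J` is the matrix
`p i j` of processing times in `[0, ∞]`. It is an instance of Restricted Assignment if every job
`j` has a finite size `s j` with `p i j ∈ {s j, ∞}` for all machines `i`. -/
def IsRestrictedAssignment {M : Type u} {J : Type v} (p : M → J → ℝ≥0∞) : Prop :=
  ∃ s : J → ℝ≥0, ∀ i j, p i j = (s j : ℝ≥0∞) ∨ p i j = ∞

open Classical in
/-- The makespan of a solution `σ : J → M`: the highest load among all machines. -/
noncomputable def makespan {M : Type u} {J : Type v} [Fintype J]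
    (p : M → J → ℝ≥0∞) (σ : J → M) : ℝ≥0∞ :=
  ⨆ i, ∑ j with σ j = i, p i j

/-- The optimum of the instance: the smallest makespan of a solution. -/
noncomputable def opt {M : Type u} {J : Type v} [Fintype J] (p : M → J → ℝ≥0∞) : ℝ≥0∞ :=
  ⨅ σ : J → M, makespan p σ

open Classical in
/-- The set `𝒞_i(T)` of configurations of the machine `i` for the target makespan `T`. -/
noncomputable def configs {M : Type u} {J : Type v} [Fintype J]
    (p : M → J → ℝ≥0∞) (T : ℝ≥0) (i : M) : Finset (Finset J) :=
  {C | ∑ j ∈ C, p i j ≤ (T : ℝ≥0∞)}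

open Classical in
/-- `x` is a feasible solution of the configuration-LP for the target makespan `T`.
Only the values `x i C` with `C ∈ 𝒞_i(T)` matter. -/
structure IsLPSolution {M : Type u} {J : Type v} [Fintype M] [Fintype J]
    (p : M → J → ℝ≥0∞) (T : ℝ≥0) (x : M → Finset J → ℝ) : Prop where
  nonneg : ∀ i, ∀ C ∈ configs p T i, 0 ≤ x i C
  machine : ∀ i, ∑ C ∈ configs p T i, x i C ≤ 1
  job : ∀ j, 1 ≤ ∑ i, ∑ C ∈ configs p T i with j ∈ C, x i C

/-- The configuration-LP is feasible for the target makespan `T`. -/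
def LPFeasible {M : Type u} {J : Type v} [Fintype M] [Fintype J]
    (p : M → J → ℝ≥0∞) (T : ℝ≥0) : Prop :=
  ∃ x : M → Finset J → ℝ, IsLPSolution p T x

/-- The optimum `OPT*` of the configuration-LP: the least (infimum) `T` for which it is feasible
(`∞` if there is none). -/
noncomputable def lpOpt {M : Type u} {J : Type v} [Fintype M] [Fintype J]
    (p : M → J → ℝ≥0∞) : ℝ≥0∞ :=
  ⨅ (T : ℝ≥0) (_ : LPFeasible p T), (T : ℝ≥0∞)

/-- The integrality gap of the configuration-LP for Restricted Assignment: the supremum of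
`OPT / OPT*` over all instances. The quotient is taken in `[0, ∞]`: it is `∞` if
`OPT* = 0 < OPT` or `OPT* < ∞ = OPT`, and it is `0` if `OPT = OPT* = 0` or `OPT* = ∞`. -/
noncomputable def integralityGap : ℝ≥0∞ :=
  ⨆ (M : Type u) (J : Type v) (_ : Fintype M) (_ : Fintype J) (p : M → J → ℝ≥0∞)
    (_ : IsRestrictedAssignment p), opt p / lpOpt p

end Scheduling

/-! Jobs enter a partial schedule of makespan at most `11 / 6 * T` one at a time. To insert `new`, a
local search moves other jobs, guided by a list of blockers: each records a job that wants to enter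
a machine, and makes jobs on that machine movable in turn. Every step of `exists_better` lowers a
lexicographic potential, so if `new` can never be inserted, the search gets stuck
(`exists_isFinal`).

A stuck state contradicts LP duality (`not_isFinal`). Movable and locked jobs get the value `min
(size) (5 / 6 * T)`, all others `0`. A machine with a full blocker costs `T`, any other machine the
total value of its jobs. By `IsFinal.sum_jobValue_le` no configuration is worth more than its
machine costs, so weak duality (`IsLPSolution.sum_le_sum`) bounds the total value by the total cost.

On the other hand, the fully blocked machines together carry at least their cost. A full blocker of
a small job has surplus at least `T / 6`; one of a big job has surplus at least `0`, or at least `-T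
/ 6` if it is deficient. The invariant `Good` lets a deficient blocker be followed only by a full
blocker of a small job, which pays for it (`Good.le_sum_surplus`). As `new` lies on no machine and
has positive value, the total value exceeds the total cost. -/

namespace Scheduling

/-! ### Blockers and the invariant of the local search -/

/-- An instance of Restricted Assignment, given by real sizes and the allowed pairs of machines and
jobs, together with a target makespan `T` that bounds all sizes. -/
structure RestrictedInstance (M : Type u) (J : Type v) where
  size : J → ℝ
  allowed : M → J → Prop
  T : ℝ
  T_nonneg : 0 ≤ T
  size_nonneg : ∀ j, 0 ≤ size j
  size_le : ∀ j, size j ≤ T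

/-- A blocker records that `job` cannot be moved to `mach` yet. If it is `full`, all jobs on
`mach` should leave, otherwise only the smallest big ones. -/
structure Blocker (M : Type u) (J : Type v) where
  job : J
  mach : M
  full : Bool

/-- The machine `i` carries a full blocker of `L`. -/
def IsFull {M : Type u} {J : Type v} (L : List (Blocker M J)) (i : M) : Prop :=
  ∃ B ∈ L, B.full = true ∧ B.mach = i

theorem isFull_cons {M : Type u} {J : Type v} {B : Blocker M J} {L : List (Blocker M J)} {i : M} :
    IsFull (B :: L) i ↔ (B.full = true ∧ B.mach = i) ∨ IsFull L i := by
  simp [IsFull]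

open Classical in
/-- The jobs that the partial schedule `σ` assigns to `i`. -/
noncomputable def jobsOn {M : Type u} {J : Type v} [Fintype J] (σ : J → Option M) (i : M) :
    Finset J := {j | σ j = some i}

theorem mem_jobsOn {M : Type u} {J : Type v} [Fintype J] {σ : J → Option M} {i : M} {j : J} :
    j ∈ jobsOn σ i ↔ σ j = some i := by
  simp [jobsOn]

namespace RestrictedInstance

open Classical

variable {M : Type u} {J : Type v} [Fintype J] (I : RestrictedInstance M J)

/-- A job is big if its size exceeds half of the target makespan. -/
def IsBig (j : J) : Prop := I.T / 2 < I.size j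

/-- The load of a machine under a partial schedule. -/
noncomputable def load (σ : J → Option M) (i : M) : ℝ := ∑ j ∈ jobsOn σ i, I.size j

/-- The big jobs on a machine. -/
noncomputable def bigsOn (σ : J → Option M) (i : M) : Finset J := {j | σ j = some i ∧ I.IsBig j}

/-- The small jobs on `i` that are not allowed on any other machine without a full blocker. -/
noncomputable def locked (σ : J → Option M) (L : List (Blocker M J)) (i : M) : Finset J :=
  {j | σ j = some i ∧ ¬ I.IsBig j ∧ ∀ i', I.allowed i' j → i' = i ∨ IsFull L i'}

/-- The total size of the locked jobs. -/
noncomputable def lockedLoad (σ : J → Option M) (L : List (Blocker M J)) (i : M) : ℝ :=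
  ∑ j ∈ I.locked σ L i, I.size j

/-- The jobs that should leave the machine of the blocker `B`. -/
def Undesirable (σ : J → Option M) (B : Blocker M J) (j : J) : Prop :=
  σ j = some B.mach ∧
    (B.full = true ∨ I.IsBig j ∧ ∀ b ∈ I.bigsOn σ B.mach, I.size j ≤ I.size b)

/-- The job `j` is either the unassigned job `new` or undesirable for some blocker. -/
def Movable (new : J) (σ : J → Option M) (L : List (Blocker M J)) (j : J) : Prop :=
  j = new ∨ ∃ B ∈ L, I.Undesirable σ B j

/-- The big jobs on `i` and all jobs that are larger than one of them. -/
noncomputable def upperJobs (σ : J → Option M) (i : M) : Finset J :=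
  {j | j ∈ I.bigsOn σ i ∨ ∃ b ∈ I.bigsOn σ i, I.size b < I.size j}

/-- The entry of a blocker in the lexicographic potential. -/
noncomputable def rank (σ : J → Option M) (B : Blocker M J) : ℕ :=
  if B.full = true then (jobsOn σ B.mach).card
  else Fintype.card J + (I.upperJobs σ B.mach).card

/-- The blocker `B` may follow the older blockers `P`. -/
structure Admissible (new : J) (σ : J → Option M) (P : List (Blocker M J)) (B : Blocker M J) :
    Prop where
  allowed : I.allowed B.mach B.job
  movable : I.Movable new σ P B.job
  not_on : σ B.job ≠ some B.mach
  not_full : ¬ IsFull P B.mach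
  of_full : B.full = true → I.IsBig B.job →
    (I.bigsOn σ B.mach = ∅ ∧ I.lockedLoad σ P B.mach + I.size B.job ≤ 11 / 6 * I.T) ∨
    ∃ b ∈ I.bigsOn σ B.mach, (∃ C ∈ P, I.Undesirable σ C b) ∧ I.size b < I.size B.job ∧
      I.lockedLoad σ P B.mach + I.size b + I.size B.job ≤ 11 / 6 * I.T
  of_least : B.full = false → I.IsBig B.job ∧ (I.bigsOn σ B.mach).Nonempty ∧
    (∀ C ∈ P, C.full = false → C.mach ≠ B.mach) ∧
    I.lockedLoad σ P B.mach + I.size B.job ≤ 11 / 6 * I.T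

/-- The job of the blocker does not fit on its machine. -/
def Blocks (σ : J → Option M) (B : Blocker M J) : Prop :=
  B.full = true → 11 / 6 * I.T < I.load σ B.mach + I.size B.job

/-- A full blocker of a big job on a machine with at most one big job. -/
def Deficient (σ : J → Option M) (B : Blocker M J) : Prop :=
  B.full = true ∧ I.IsBig B.job ∧ (I.bigsOn σ B.mach).card ≤ 1

/-- The invariant of the list of blockers, the newest one first. -/
def Good (new : J) (σ : J → Option M) : List (Blocker M J) → Prop
  | [] => True
  | B :: P => I.Admissible new σ P B ∧
      (∀ C ∈ P.head?, I.Blocks σ C ∧ (I.Deficient σ C → B.full = true ∧ ¬ I.IsBig B.job)) ∧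
      Good new σ P

/-- A partial schedule of the jobs in `D` with makespan at most `11 / 6 * T`. -/
structure IsPartial (D : Finset J) (σ : J → Option M) : Prop where
  eq_none_iff : ∀ j, σ j = none ↔ j ∉ D
  allowed : ∀ j i, σ j = some i → I.allowed i j
  load_le : ∀ i, I.load σ i ≤ 11 / 6 * I.T

/-- The job `j` moves from `i₀` to `i` without being undesirable for any blocker of `P`. -/
structure Shift (σ : J → Option M) (P : List (Blocker M J)) (j : J) (i₀ i : M) : Prop where
  src : σ j = some i₀
  ne : i₀ ≠ i
  allowed_src : I.allowed i₀ j
  allowed_dst : I.allowed i j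
  not_full : ¬ IsFull P i
  not_undesirable : ∀ C ∈ P, ¬ I.Undesirable σ C j
  larger : ∀ C ∈ P, C.full = false → C.mach = i → I.IsBig j →
    ∃ b ∈ I.bigsOn σ i, I.size b < I.size j

variable {I} {new : J} {σ : J → Option M} {P L : List (Blocker M J)} {B C : Blocker M J} {j : J}
  {i i₀ : M} {D : Finset J}

theorem mem_bigsOn : j ∈ I.bigsOn σ i ↔ σ j = some i ∧ I.IsBig j := by
  simp [bigsOn]

theorem mem_locked : j ∈ I.locked σ L i ↔
    σ j = some i ∧ ¬ I.IsBig j ∧ ∀ i', I.allowed i' j → i' = i ∨ IsFull L i' := by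
  simp [locked]

theorem mem_upperJobs : j ∈ I.upperJobs σ i ↔
    j ∈ I.bigsOn σ i ∨ ∃ b ∈ I.bigsOn σ i, I.size b < I.size j := by
  simp [upperJobs]

theorem rank_le (B : Blocker M J) : I.rank σ B ≤ 2 * Fintype.card J := by
  unfold rank
  split_ifs
  · have := Finset.card_le_univ (jobsOn σ B.mach)
    omega
  · have := Finset.card_le_univ (I.upperJobs σ B.mach)
    omega

theorem Good.of_append {Q : List (Blocker M J)} (h : I.Good new σ (Q ++ P)) :
    I.Good new σ P := by
  induction Q with
  | nil => exact h
  | cons B Q ih => exact ih h.2.2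

theorem Good.nonempty_of_mem (h : I.Good new σ P) (hC : C ∈ P) (hl : C.full = false) :
    (I.bigsOn σ C.mach).Nonempty := by
  induction P with
  | nil => simp at hC
  | cons B P ih =>
    rcases List.mem_cons.1 hC with rfl | hC
    · exact (h.1.of_least hl).2.1
    · exact ih h.2.2 hC

/-- This bounds the number of blockers by twice the number of machines, so that the potential fits
into a vector of fixed length. -/
theorem Good.nodup (h : I.Good new σ P) : (P.map fun B => (B.mach, B.full)).Nodup := by
  induction P with
  | nil => simp
  | cons B P ih =>
    rw [List.map_cons, List.nodup_cons]
    refine ⟨fun hmem => ?_, ih h.2.2⟩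
    obtain ⟨C, hC, hCB⟩ := List.mem_map.1 hmem
    simp only [Prod.mk.injEq] at hCB
    cases hB : B.full with
    | true => exact h.1.not_full ⟨C, hC, hCB.2.trans hB, hCB.1⟩
    | false => exact (h.1.of_least hB).2.2.1 C hC (hCB.2.trans hB) hCB.1

theorem Good.length_le [Fintype M] (h : I.Good new σ P) :
    P.length ≤ Fintype.card (M × Bool) := by
  simpa using h.nodup.length_le_card

/-! ### Moves that leave the older blockers intact -/

namespace Shift

theorem tail (h : I.Shift σ (B :: P) j i₀ i) : I.Shift σ P j i₀ i where
  src := h.src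
  ne := h.ne
  allowed_src := h.allowed_src
  allowed_dst := h.allowed_dst
  not_full := fun hf => h.not_full (isFull_cons.2 (Or.inr hf))
  not_undesirable := fun C hC => h.not_undesirable C (List.mem_cons_of_mem _ hC)
  larger := fun C hC => h.larger C (List.mem_cons_of_mem _ hC)

theorem not_full_src (h : I.Shift σ P j i₀ i) : ¬ IsFull P i₀ := by
  rintro ⟨C, hC, hf, rfl⟩
  exact h.not_undesirable C hC ⟨h.src, Or.inl hf⟩

theorem assigned_iff_of_full (h : I.Shift σ P j i₀ i) (hC : C ∈ P) (hf : C.full = true) (d : J) :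
    Function.update σ j (some i) d = some C.mach ↔ σ d = some C.mach := by
  by_cases hd : d = j
  · subst hd
    have h1 : i ≠ C.mach := fun e => h.not_full ⟨C, hC, hf, e.symm⟩
    have h2 : i₀ ≠ C.mach := fun e => h.not_full_src ⟨C, hC, hf, e.symm⟩
    simp [h.src, h1, h2]
  · simp [hd]

theorem jobsOn_eq_of_full (h : I.Shift σ P j i₀ i) (hC : C ∈ P) (hf : C.full = true) :
    jobsOn (Function.update σ j (some i)) C.mach = jobsOn σ C.mach := by
  ext d
  simp only [mem_jobsOn, h.assigned_iff_of_full hC hf]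

theorem bigsOn_eq_of_full (h : I.Shift σ P j i₀ i) (hC : C ∈ P) (hf : C.full = true) :
    I.bigsOn (Function.update σ j (some i)) C.mach = I.bigsOn σ C.mach := by
  ext d
  simp only [mem_bigsOn, h.assigned_iff_of_full hC hf]

theorem mem_bigsOn_iff (d : J) (hd : d ≠ j) (m : M) :
    d ∈ I.bigsOn (Function.update σ j (some i)) m ↔ d ∈ I.bigsOn σ m := by
  simp [mem_bigsOn, hd]

/-- A big job entering the machine is larger than some big job there by `larger`; one leaving it is
not undesirable, hence not a smallest big job. Either way a smaller big job stays, so the minimum is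
unaffected. -/
theorem bigsOn_of_least (h : I.Shift σ P j i₀ i) (hC : C ∈ P) (hl : C.full = false) :
    I.bigsOn (Function.update σ j (some i)) C.mach = I.bigsOn σ C.mach ∨
      ∃ b ∈ I.bigsOn σ C.mach, I.size b < I.size j := by
  by_cases hb : I.IsBig j
  · by_cases h1 : i = C.mach
    · subst h1
      exact Or.inr (h.larger C hC hl rfl hb)
    · by_cases h2 : i₀ = C.mach
      · right
        by_contra! hcon
        exact h.not_undesirable C hC ⟨h2 ▸ h.src, Or.inr ⟨hb, hcon⟩⟩
      · left
        ext d
        by_cases hd : d = j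
        · subst hd
          simp [mem_bigsOn, h.src, h1, h2]
        · exact mem_bigsOn_iff d hd _
  · left
    ext d
    by_cases hd : d = j
    · subst hd
      simp [mem_bigsOn, hb]
    · exact mem_bigsOn_iff d hd _

theorem undesirable_iff (h : I.Shift σ P j i₀ i) (hC : C ∈ P) (d : J) :
    I.Undesirable (Function.update σ j (some i)) C d ↔ I.Undesirable σ C d := by
  cases hl : C.full with
  | true => simp only [Undesirable, hl, true_or, and_true, h.assigned_iff_of_full hC hl]
  | false =>
    have key : ∀ τ : J → Option M, I.Undesirable τ C d ↔
        d ∈ I.bigsOn τ C.mach ∧ ∀ b ∈ I.bigsOn τ C.mach, I.size d ≤ I.size b := by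
      intro τ
      simp only [Undesirable, hl, mem_bigsOn]
      simp [and_assoc]
    rw [key, key]
    rcases h.bigsOn_of_least hC hl with he | ⟨b, hb, hbj⟩
    · rw [he]
    · have hbne : b ≠ j := fun e => by simp [e] at hbj
      have hb' := (mem_bigsOn_iff (i := i) b hbne C.mach).2 hb
      by_cases hd : d = j
      · subst hd
        exact ⟨fun hh => absurd (hh.2 b hb') (by linarith),
          fun hh => absurd (hh.2 b hb) (by linarith)⟩
      · rw [mem_bigsOn_iff d hd]
        refine and_congr_right fun _ => ⟨fun hh e he => ?_, fun hh e he => ?_⟩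
        · by_cases hej : e = j
          · have := hh b hb'
            rw [hej]
            linarith
          · exact hh e ((mem_bigsOn_iff e hej _).2 he)
        · by_cases hej : e = j
          · have := hh b hb
            rw [hej]
            linarith
          · exact hh e ((mem_bigsOn_iff e hej _).1 he)

theorem nonempty_bigsOn (h : I.Shift σ P j i₀ i) (hC : C ∈ P) (hl : C.full = false)
    (hne : (I.bigsOn σ C.mach).Nonempty) :
    (I.bigsOn (Function.update σ j (some i)) C.mach).Nonempty := by
  rcases h.bigsOn_of_least hC hl with he | ⟨b, hb, hbj⟩
  · rwa [he]
  · have hbne : b ≠ j := fun e => by simp [e] at hbj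
    exact ⟨b, (mem_bigsOn_iff (i := i) b hbne C.mach).2 hb⟩

/-- This is why the rank counts `upperJobs` and not the big jobs on the machine: big jobs above the
minimum may come and go, but they are counted wherever they are. -/
theorem upperJobs_eq (h : I.Shift σ P j i₀ i) (hC : C ∈ P) (hl : C.full = false) :
    I.upperJobs (Function.update σ j (some i)) C.mach = I.upperJobs σ C.mach := by
  rcases h.bigsOn_of_least hC hl with he | ⟨b, hb, hbj⟩
  · simp only [upperJobs, he]
  · have hbne : b ≠ j := fun e => by simp [e] at hbj
    have hb' := (mem_bigsOn_iff (i := i) b hbne C.mach).2 hb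
    ext d
    rw [mem_upperJobs, mem_upperJobs]
    by_cases hd : d = j
    · subst hd
      exact ⟨fun _ => Or.inr ⟨b, hb, hbj⟩, fun _ => Or.inr ⟨b, hb', hbj⟩⟩
    · rw [mem_bigsOn_iff d hd]
      refine or_congr_right ⟨?_, ?_⟩
      · rintro ⟨e, he, hed⟩
        by_cases hej : e = j
        · exact ⟨b, hb, by rw [hej] at hed; linarith⟩
        · exact ⟨e, (mem_bigsOn_iff e hej _).1 he, hed⟩
      · rintro ⟨e, he, hed⟩
        by_cases hej : e = j
        · exact ⟨b, hb', by rw [hej] at hed; linarith⟩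
        · exact ⟨e, (mem_bigsOn_iff e hej _).2 he, hed⟩

theorem rank_eq (h : I.Shift σ P j i₀ i) (hC : C ∈ P) :
    I.rank (Function.update σ j (some i)) C = I.rank σ C := by
  cases hl : C.full with
  | true => simp [rank, hl, h.jobsOn_eq_of_full hC hl]
  | false => simp [rank, hl, h.upperJobs_eq hC hl]

/-- The moved job is locked neither before nor after, since its source and its target are two
allowed machines without full blocker. -/
theorem locked_eq (h : I.Shift σ P j i₀ i) (m : M) :
    I.locked (Function.update σ j (some i)) P m = I.locked σ P m := by
  ext d
  rw [mem_locked, mem_locked]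
  by_cases hd : d = j
  · subst hd
    constructor
    · rintro ⟨h1, -, h3⟩
      simp only [Function.update_self, Option.some.injEq] at h1
      subst h1
      rcases h3 _ h.allowed_src with h4 | h4
      · exact absurd h4 h.ne
      · exact absurd h4 h.not_full_src
    · rintro ⟨h1, -, h3⟩
      rw [h.src, Option.some.injEq] at h1
      subst h1
      rcases h3 _ h.allowed_dst with h4 | h4
      · exact absurd h4.symm h.ne
      · exact absurd h4 h.not_full
  · simp [hd]

theorem lockedLoad_eq (h : I.Shift σ P j i₀ i) (m : M) :
    I.lockedLoad (Function.update σ j (some i)) P m = I.lockedLoad σ P m := by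
  simp only [lockedLoad, h.locked_eq]

theorem not_movable (h : I.Shift σ P j i₀ i) (hj : j ≠ new) : ¬ I.Movable new σ P j := by
  rintro (h1 | ⟨C, hC, hu⟩)
  · exact hj h1
  · exact h.not_undesirable C hC hu

theorem movable_iff (h : I.Shift σ P j i₀ i) (d : J) :
    I.Movable new (Function.update σ j (some i)) P d ↔ I.Movable new σ P d := by
  refine or_congr_right (exists_congr fun C => and_congr_right fun hC => h.undesirable_iff hC d)

theorem admissible (h : I.Shift σ (B :: P) j i₀ i) (hj : j ≠ new)
    (hB : I.Admissible new σ P B) : I.Admissible new (Function.update σ j (some i)) P B := by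
  have hne : B.job ≠ j := fun e => h.tail.not_movable hj (e ▸ hB.movable)
  have hmem : B ∈ B :: P := List.mem_cons_self
  refine ⟨hB.allowed, (h.tail.movable_iff _).2 hB.movable, ?_, hB.not_full, ?_, ?_⟩
  · rw [Function.update_of_ne hne]
    exact hB.not_on
  · intro hf hbig
    rw [h.bigsOn_eq_of_full hmem hf, h.tail.lockedLoad_eq]
    rcases hB.of_full hf hbig with h1 | ⟨b, hb, ⟨C, hC, hu⟩, h2⟩
    · exact Or.inl h1
    · exact Or.inr ⟨b, hb, ⟨C, hC, (h.tail.undesirable_iff hC b).2 hu⟩, h2⟩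
  · intro hl
    obtain ⟨h1, h2, h3, h4⟩ := hB.of_least hl
    exact ⟨h1, h.nonempty_bigsOn hmem hl h2, h3, by rwa [h.tail.lockedLoad_eq]⟩

theorem blocks_iff (h : I.Shift σ P j i₀ i) (hC : C ∈ P) :
    I.Blocks (Function.update σ j (some i)) C ↔ I.Blocks σ C := by
  refine forall_congr' fun hf => ?_
  rw [load, load, h.jobsOn_eq_of_full hC hf]

theorem deficient_iff (h : I.Shift σ P j i₀ i) (hC : C ∈ P) :
    I.Deficient (Function.update σ j (some i)) C ↔ I.Deficient σ C := by
  refine and_congr_right fun hf => ?_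
  rw [h.bigsOn_eq_of_full hC hf]

theorem good (h : I.Shift σ P j i₀ i) (hj : j ≠ new) (hP : I.Good new σ P) :
    I.Good new (Function.update σ j (some i)) P := by
  induction P with
  | nil => trivial
  | cons B P ih =>
    refine ⟨h.admissible hj hP.1, fun C hC => ?_, ih h.tail hP.2.2⟩
    have hmem : C ∈ P := List.mem_of_mem_head? hC
    rw [h.tail.blocks_iff hmem, h.tail.deficient_iff hmem]
    exact hP.2.1 C hC

end Shift

/-! ### Improving steps -/

/-- The list `L'` under `σ'` is lexicographically smaller than `L` under `σ`. -/
def Better (I : RestrictedInstance M J) (σ' : J → Option M) (L' : List (Blocker M J))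
    (σ : J → Option M) (L : List (Blocker M J)) : Prop :=
  ∃ B' P, L' = B' :: P ∧ (∀ C ∈ P, I.rank σ' C = I.rank σ C) ∧
    (L = P ∨ ∃ Q B, L = Q ++ B :: P ∧ I.rank σ' B' < I.rank σ B)

theorem Better.of_tail {σ' : J → Option M} {L' Q : List (Blocker M J)} {σ : J → Option M}
    {L : List (Blocker M J)} (hL : ∃ B' P R B, L' = B' :: P ∧
      (∀ C ∈ P, I.rank σ' C = I.rank σ C) ∧ L = R ++ B :: P ∧ I.rank σ' B' < I.rank σ B) :
    I.Better σ' L' σ (Q ++ L) := by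
  obtain ⟨B', P, R, B, h1, h2, rfl, h4⟩ := hL
  exact ⟨B', P, h1, h2, Or.inr ⟨Q ++ R, B, by simp, h4⟩⟩

/-- Choosing the oldest such blocker makes moving `j` a `Shift` for all blockers before it; the
newer ones are discarded. -/
theorem exists_oldest_undesirable (h : ∃ B ∈ L, I.Undesirable σ B j) :
    ∃ Q B P, L = Q ++ B :: P ∧ I.Undesirable σ B j ∧ ∀ C ∈ P, ¬ I.Undesirable σ C j := by
  induction L with
  | nil => simp at h
  | cons A L ih =>
    by_cases h' : ∃ B ∈ L, I.Undesirable σ B j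
    · obtain ⟨Q, B, P, rfl, h2⟩ := ih h'
      exact ⟨A :: Q, B, P, rfl, h2⟩
    · push Not at h'
      obtain ⟨B, hB, hu⟩ := h
      rcases List.mem_cons.1 hB with rfl | hB
      · exact ⟨[], B, L, rfl, hu, h'⟩
      · exact absurd hu (h' B hB)

theorem load_update_le (h : I.load σ i + I.size j ≤ 11 / 6 * I.T) (hj : σ j ≠ some i)
    (hσ : ∀ i, I.load σ i ≤ 11 / 6 * I.T) (m : M) :
    I.load (Function.update σ j (some i)) m ≤ 11 / 6 * I.T := by
  by_cases hm : m = i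
  · subst hm
    have : jobsOn (Function.update σ j (some m)) m = insert j (jobsOn σ m) := by
      ext d
      by_cases hd : d = j
      · simp [mem_jobsOn, hd]
      · simp [mem_jobsOn, hd]
    rw [load, this, Finset.sum_insert (by simpa [mem_jobsOn] using hj)]
    unfold load at h
    linarith
  · refine le_trans (Finset.sum_le_sum_of_subset_of_nonneg (fun d hd => ?_)
      fun d _ _ => I.size_nonneg d) (hσ m)
    rw [mem_jobsOn] at hd ⊢
    by_cases hdj : d = j
    · subst hdj
      simp [Ne.symm hm] at hd
    · rwa [Function.update_of_ne hdj] at hd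

theorem IsPartial.update (hσ : I.IsPartial D σ) (h : I.load σ i + I.size j ≤ 11 / 6 * I.T)
    (hj : σ j ≠ some i) (hi : I.allowed i j) :
    I.IsPartial (insert j D) (Function.update σ j (some i)) where
  eq_none_iff d := by
    by_cases hd : d = j
    · simp [hd]
    · simp [hd, hσ.eq_none_iff]
  allowed d m hdm := by
    by_cases hd : d = j
    · subst hd
      simp only [Function.update_self, Option.some.injEq] at hdm
      exact hdm ▸ hi
    · rw [Function.update_of_ne hd] at hdm
      exact hσ.allowed d m hdm
  load_le := load_update_le h hj hσ.load_le

/-- Moving an undesirable job improves the potential. -/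
theorem exists_better_of_move (hσ : I.IsPartial D σ) (hL : I.Good new σ L)
    (hu : ∃ B ∈ L, I.Undesirable σ B j) (hnew : j ≠ new) (hji : σ j ≠ some i)
    (hi : I.allowed i j) (hf : ¬ IsFull L i) (hload : I.load σ i + I.size j ≤ 11 / 6 * I.T)
    (hlarger : ∀ C ∈ L, C.full = false → C.mach = i → I.IsBig j →
      ∃ b ∈ I.bigsOn σ i, I.size b < I.size j) :
    ∃ σ' L', I.IsPartial D σ' ∧ I.Good new σ' L' ∧ ∃ B' P R B, L' = B' :: P ∧
      (∀ C ∈ P, I.rank σ' C = I.rank σ C) ∧ L = R ++ B :: P ∧ I.rank σ' B' < I.rank σ B := by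
  obtain ⟨Q, B, P, rfl, hB, hP⟩ := exists_oldest_undesirable hu
  have hjD : j ∈ D := by
    by_contra hcon
    rw [← hσ.eq_none_iff] at hcon
    rw [Undesirable, hcon] at hB
    simp at hB
  have hgood := hL.of_append
  have hshift : I.Shift σ P j B.mach i :=
    { src := hB.1
      ne := fun e => hji (e ▸ hB.1)
      allowed_src := hσ.allowed _ _ hB.1
      allowed_dst := hi
      not_full := fun ⟨C, hC, h⟩ => hf ⟨C, by simp [hC], h⟩
      not_undesirable := hP
      larger := fun C hC => hlarger C (by simp [hC]) }
  set σ' := Function.update σ j (some i) with hσ'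
  have hon : ∀ d, σ' d = some B.mach → σ d = some B.mach ∧ d ≠ j := by
    intro d hd
    by_cases hdj : d = j
    · subst hdj
      rw [hσ', Function.update_self, Option.some.injEq] at hd
      exact absurd hd.symm hshift.ne
    · exact ⟨by rwa [hσ', Function.update_of_ne hdj] at hd, hdj⟩
  have hon' : ∀ d, σ d = some B.mach → d ≠ j → σ' d = some B.mach := by
    intro d hd hdj
    rwa [hσ', Function.update_of_ne hdj]
  have hlocked : I.lockedLoad σ' P B.mach = I.lockedLoad σ P B.mach := hshift.lockedLoad_eq _
  have hjob : B.job ≠ j := fun e => hshift.not_movable hnew (e ▸ hgood.1.movable)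
  have hmov := (hshift.movable_iff (new := new) B.job).2 hgood.1.movable
  have hnot_on : σ' B.job ≠ some B.mach := fun h => hgood.1.not_on (hon _ h).1
  have hchain : ∀ C ∈ P.head?, I.Blocks σ' C ∧ (I.Deficient σ' C → B.full = true ∧
      ¬ I.IsBig B.job) := by
    intro C hC
    have hmem : C ∈ P := List.mem_of_mem_head? hC
    rw [hshift.blocks_iff hmem, hshift.deficient_iff hmem]
    exact hgood.2.1 C hC
  have hcard : (jobsOn σ' B.mach).card < (jobsOn σ B.mach).card := by
    refine Finset.card_lt_card ((Finset.ssubset_iff_of_subset fun d hd => ?_).2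
      ⟨j, mem_jobsOn.2 hB.1, fun hd => ?_⟩)
    · exact mem_jobsOn.2 (hon d (mem_jobsOn.1 hd)).1
    · exact (hon j (mem_jobsOn.1 hd)).2 rfl
  refine ⟨σ', ?_⟩
  suffices h : ∃ B' : Blocker M J, I.Good new σ' (B' :: P) ∧ I.rank σ' B' < I.rank σ B by
    obtain ⟨B', h1, h2⟩ := h
    refine ⟨B' :: P, ?_, h1, B', P, Q, B, rfl, fun C hC => hshift.rank_eq hC, rfl, h2⟩
    have := hσ.update hload hji hi
    rwa [Finset.insert_eq_of_mem hjD] at this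
  cases hfull : B.full with
  | true =>
    refine ⟨B, ⟨⟨hgood.1.allowed, hmov, hnot_on, hgood.1.not_full, ?_, ?_⟩, hchain,
      hshift.good hnew hgood.2.2⟩, ?_⟩
    · intro _ hbig
      rw [hlocked]
      rcases hgood.1.of_full hfull hbig with ⟨h1, h2⟩ | ⟨b, hb, ⟨C, hC, hCu⟩, h2⟩
      · refine Or.inl ⟨Finset.eq_empty_of_forall_notMem fun d hd => ?_, h2⟩
        rw [mem_bigsOn] at hd
        have : d ∈ I.bigsOn σ B.mach := mem_bigsOn.2 ⟨(hon d hd.1).1, hd.2⟩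
        simp [h1] at this
      -- The witness `b` is undesirable for a blocker older than `B`, so it is not the moved job and
      -- stays on the machine.
      · refine Or.inr ⟨b, ?_, ⟨C, hC, (hshift.undesirable_iff hC b).2 hCu⟩, h2⟩
        rw [mem_bigsOn] at hb ⊢
        exact ⟨hon' b hb.1 fun e => hP C hC (e ▸ hCu), hb.2⟩
    · intro h
      simp [hfull] at h
    · simpa only [rank, hfull, if_true] using hcard
  | false =>
    obtain ⟨h1, h2, h3, h4⟩ := hgood.1.of_least hfull
    by_cases hne : (I.bigsOn σ' B.mach).Nonempty
    · refine ⟨B, ⟨⟨hgood.1.allowed, hmov, hnot_on, hgood.1.not_full, ?_, ?_⟩, hchain,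
        hshift.good hnew hgood.2.2⟩, ?_⟩
      · intro h
        simp [hfull] at h
      · intro _
        exact ⟨h1, hne, h3, by rwa [hlocked]⟩
      · simp only [rank, hfull, Bool.false_eq_true, if_false]
        obtain ⟨-, hB2⟩ := hB
        simp only [hfull, Bool.false_eq_true, false_or] at hB2
        have hsub : ∀ d ∈ I.bigsOn σ' B.mach, d ∈ I.bigsOn σ B.mach := fun d hd =>
          mem_bigsOn.2 ⟨(hon d (mem_bigsOn.1 hd).1).1, (mem_bigsOn.1 hd).2⟩
        refine Nat.add_lt_add_left (Finset.card_lt_card ((Finset.ssubset_iff_of_subset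
          fun d hd => ?_).2 ⟨j, ?_, fun hd => ?_⟩)) _
        · rw [mem_upperJobs] at hd ⊢
          rcases hd with hd | ⟨b, hb, hbd⟩
          · exact Or.inl (hsub d hd)
          · exact Or.inr ⟨b, hsub b hb, hbd⟩
        · exact mem_upperJobs.2 (Or.inl (mem_bigsOn.2 ⟨hshift.src, hB2.1⟩))
        -- The moved job was a smallest big job, so no remaining big job is smaller and it drops out
        -- of `upperJobs`.
        · rcases mem_upperJobs.1 hd with hd | ⟨b, hb, hbd⟩
          · exact (hon j (mem_bigsOn.1 hd).1).2 rfl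
          · exact absurd (hB2.2 b (hsub b hb)) (not_le.2 hbd)
    -- The last big job left, so the blocker is turned into a full one. Its rank falls because ranks
    -- of non-full blockers start at `Fintype.card J`.
    · rw [Finset.not_nonempty_iff_eq_empty] at hne
      refine ⟨⟨B.job, B.mach, true⟩, ⟨⟨hgood.1.allowed, hmov, hnot_on, hgood.1.not_full, ?_, ?_⟩,
        fun C hC => ⟨(hchain C hC).1, fun hd => ⟨rfl, ((hchain C hC).2 hd).2⟩⟩,
        hshift.good hnew hgood.2.2⟩, ?_⟩
      · intro _ _
        exact Or.inl ⟨hne, by rwa [hlocked]⟩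
      · intro h
        simp at h
      · simp only [rank, hfull, Bool.false_eq_true, if_false, if_true]
        have := Finset.card_le_univ (jobsOn σ B.mach)
        omega

theorem better_cons (σ : J → Option M) (L : List (Blocker M J)) (B : Blocker M J) :
    I.Better σ (B :: L) σ L :=
  ⟨B, L, rfl, fun _ _ => rfl, Or.inl rfl⟩

/-- Either a movable job moves, which improves the potential, or a full blocker is added. -/
theorem exists_better_of_movable (hσ : I.IsPartial D σ) (hnew : new ∉ D)
    (hext : ¬ ∃ τ, I.IsPartial (insert new D) τ) (hL : I.Good new σ L)
    (hm : I.Movable new σ L j) (hji : σ j ≠ some i) (hi : I.allowed i j) (hf : ¬ IsFull L i)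
    (hload : I.load σ i + I.size j ≤ 11 / 6 * I.T)
    (hlarger : ∀ C ∈ L, C.full = false → C.mach = i → I.IsBig j →
      ∃ b ∈ I.bigsOn σ i, I.size b < I.size j) (Q : List (Blocker M J)) :
    ∃ σ' L', I.IsPartial D σ' ∧ I.Good new σ' L' ∧ I.Better σ' L' σ (Q ++ L) := by
  by_cases hj : j = new
  · subst hj
    exact absurd ⟨_, hσ.update hload hji hi⟩ hext
  · obtain ⟨σ', L', h1, h2, h3⟩ := exists_better_of_move hσ hL
      (hm.resolve_left hj) hj hji hi hf hload hlarger
    exact ⟨σ', L', h1, h2, Better.of_tail h3⟩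

theorem bigsOn_eq_singleton_of_card_le_one {b : J} (hb : b ∈ I.bigsOn σ i)
    (hc : (I.bigsOn σ i).card ≤ 1) : I.bigsOn σ i = {b} :=
  Finset.eq_singleton_iff_unique_mem.2 ⟨hb, fun x hx => Finset.card_le_one.1 hc x hx b hb⟩

theorem load_eq_add (σ : J → Option M) (i : M) :
    I.load σ i = ∑ j ∈ I.bigsOn σ i, I.size j +
      ∑ j ∈ (jobsOn σ i).filter (fun j => ¬ I.IsBig j), I.size j := by
  rw [load, ← Finset.sum_filter_add_sum_filter_not (jobsOn σ i) I.IsBig]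
  congr 2
  ext d
  simp [mem_bigsOn, mem_jobsOn]

/-- On the machine of a deficient newest blocker some small job can still move elsewhere. -/
theorem exists_small_of_deficient (hB : I.Admissible new σ P B) (hblocks : I.Blocks σ B)
    (hdef : I.Deficient σ B) :
    ∃ d m, I.Movable new σ (B :: P) d ∧ ¬ I.IsBig d ∧ I.allowed m d ∧
      ¬ IsFull (B :: P) m ∧ σ d ≠ some m := by
  obtain ⟨hf, hbig, hcard⟩ := hdef
  have hbl := hblocks hf
  have hlock : I.lockedLoad σ P B.mach + ∑ d ∈ I.bigsOn σ B.mach, I.size d + I.size B.job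
      ≤ 11 / 6 * I.T := by
    rcases hB.of_full hf hbig with ⟨h1, h2⟩ | ⟨b, hb, -, -, h2⟩
    · rw [h1, Finset.sum_empty]
      linarith
    · rw [bigsOn_eq_singleton_of_card_le_one hb hcard, Finset.sum_singleton]
      linarith
  rw [load_eq_add] at hbl
  obtain ⟨d, hd, hdl⟩ : ∃ d ∈ (jobsOn σ B.mach).filter (fun j => ¬ I.IsBig j),
      d ∉ I.locked σ P B.mach := by
    by_contra! hcon
    have := Finset.sum_le_sum_of_subset_of_nonneg (f := I.size) hcon
      fun d _ _ => I.size_nonneg d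
    unfold lockedLoad at hlock
    linarith
  rw [Finset.mem_filter, mem_jobsOn] at hd
  rw [mem_locked] at hdl
  push Not at hdl
  obtain ⟨m, hm, hmB, hmf⟩ := hdl hd.1 hd.2
  refine ⟨d, m, Or.inr ⟨B, List.mem_cons_self, hd.1, Or.inl hf⟩, hd.2, hm, ?_, ?_⟩
  · rw [isFull_cons]
    rintro (⟨-, h⟩ | h)
    · exact hmB h.symm
    · exact hmf h
  · rw [hd.1]
    intro h
    exact hmB (Option.some.inj h).symm

/-- The state admits no further step of the local search. -/
structure IsFinal (I : RestrictedInstance M J) (new : J) (σ : J → Option M)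
    (L : List (Blocker M J)) : Prop where
  blocks : ∀ C ∈ L.head?, I.Blocks σ C ∧ ¬ I.Deficient σ C
  small : ∀ d m, I.Movable new σ L d → ¬ I.IsBig d → I.allowed m d → ¬ IsFull L m →
    σ d = some m
  big : ∀ d m, I.Movable new σ L d → I.IsBig d → I.allowed m d → ¬ IsFull L m →
    σ d ≠ some m → I.lockedLoad σ L m + I.size d ≤ 11 / 6 * I.T →
    ∃ C ∈ L, C.full = false ∧ C.mach = m ∧ ∀ b ∈ I.bigsOn σ m, I.Undesirable σ C b →
      I.size b < I.size d → 11 / 6 * I.T < I.lockedLoad σ L m + I.size b + I.size d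

/-- Every state that is not final can be improved. -/
theorem exists_better (hσ : I.IsPartial D σ) (hnew : new ∉ D)
    (hext : ¬ ∃ τ, I.IsPartial (insert new D) τ) (hL : I.Good new σ L)
    (hfin : ¬ I.IsFinal new σ L) :
    ∃ σ' L', I.IsPartial D σ' ∧ I.Good new σ' L' ∧ I.Better σ' L' σ L := by
  by_contra hno
  have happend : ∀ B, I.Admissible new σ L B →
      (∀ C ∈ L.head?, I.Blocks σ C ∧ (I.Deficient σ C → B.full = true ∧ ¬ I.IsBig B.job)) →
      False := fun B h1 h2 => hno ⟨σ, B :: L, hσ, ⟨h1, h2, hL⟩, better_cons σ L B⟩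
  have hblocks : ∀ C ∈ L.head?, I.Blocks σ C := by
    cases L with
    | nil => simp
    | cons B P =>
      intro C hC hf
      obtain rfl : B = C := by simpa using hC
      by_contra hle
      -- The job of the newest blocker fits, so it moves. A non-full older blocker on the target
      -- guarantees a big job there, which excludes the first alternative of `of_full`.
      refine hno (exists_better_of_movable hσ hnew hext hL.2.2 hL.1.movable hL.1.not_on
        hL.1.allowed hL.1.not_full (not_lt.1 hle) ?_ [B])
      intro C hC hl hm hbig
      rcases hL.1.of_full hf hbig with ⟨h1, -⟩ | ⟨b, hb, -, h2, -⟩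
      · have := hL.2.2.nonempty_of_mem hC hl
        rw [hm, h1] at this
        simp at this
      · exact ⟨b, hb, h2⟩
  have hsmall : ∀ d m, I.Movable new σ L d → ¬ I.IsBig d → I.allowed m d → ¬ IsFull L m →
      σ d = some m := by
    intro d m h1 h2 h3 h4
    by_contra h5
    exact happend ⟨d, m, true⟩ ⟨h3, h1, h5, h4, fun _ h => absurd h h2, fun h => by simp at h⟩
      -- A full blocker of a small job may be added even after a deficient one.
      fun C hC => ⟨hblocks C hC, fun _ => ⟨rfl, h2⟩⟩
  have hdef : ∀ C ∈ L.head?, ¬ I.Deficient σ C := by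
    cases L with
    | nil => simp
    | cons B P =>
      intro C hC hdef
      obtain rfl : B = C := by simpa using hC
      obtain ⟨d, m, h1, h2, h3, h4, h5⟩ := exists_small_of_deficient hL.1 (hblocks B hC) hdef
      exact h5 (hsmall d m h1 h2 h3 h4)
  have happend' : ∀ B, ¬ I.Admissible new σ L B := fun B h =>
    happend B h fun C hC => ⟨hblocks C hC, fun h => absurd h (hdef C hC)⟩
  refine hfin ⟨fun C hC => ⟨hblocks C hC, hdef C hC⟩, hsmall, ?_⟩
  intro d m h1 h2 h3 h4 h5 h6
  by_cases hne : (I.bigsOn σ m).Nonempty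
  · by_cases hex : ∃ C ∈ L, C.full = false ∧ C.mach = m
    · obtain ⟨C, hC, hl, rfl⟩ := hex
      refine ⟨C, hC, hl, rfl, fun b hb hu hlt => ?_⟩
      by_contra hle
      exact happend' ⟨d, C.mach, true⟩ ⟨h3, h1, h5, h4,
        fun _ _ => Or.inr ⟨b, hb, ⟨C, hC, hu⟩, hlt, not_lt.1 hle⟩, fun h => by simp at h⟩
    · push Not at hex
      exact absurd ⟨h3, h1, h5, h4, fun h => by simp at h, fun _ => ⟨h2, hne, hex, h6⟩⟩
        (happend' ⟨d, m, false⟩)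
  · rw [Finset.not_nonempty_iff_eq_empty] at hne
    exact absurd ⟨h3, h1, h5, h4, fun _ _ => Or.inl ⟨hne, h6⟩, fun h => by simp at h⟩
      (happend' ⟨d, m, true⟩)

/-! ### Termination -/

/-- The potential as a vector, oldest blocker first, padded by a large number. -/
noncomputable def potential (I : RestrictedInstance M J) (N : ℕ) (σ : J → Option M)
    (L : List (Blocker M J)) : Lex (Fin N → ℕ) :=
  -- The padding exceeds every rank by `rank_le`, so adding a blocker also lowers the potential.
  toLex fun k => ((L.map (I.rank σ)).reverse)[(k : ℕ)]?.getD (2 * Fintype.card J + 1)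

theorem Better.potential_lt {N : ℕ} {σ' : J → Option M} {L' : List (Blocker M J)}
    (h : I.Better σ' L' σ L) (hN : L'.length ≤ N) :
    I.potential N σ' L' < I.potential N σ L := by
  obtain ⟨B', P, rfl, hP, hL⟩ := h
  have hP' : P.map (I.rank σ') = P.map (I.rank σ) := List.map_congr_left hP
  simp only [List.length_cons] at hN
  refine ⟨⟨P.length, by omega⟩, fun k hk => ?_, ?_⟩
  · have hk' : (k : ℕ) < P.length := hk
    rcases hL with rfl | ⟨Q, B, rfl, -⟩
    · simp [potential, hP', List.getElem?_append, hk']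
    · simp [potential, hP', List.getElem?_append, hk']
  · rcases hL with rfl | ⟨Q, B, rfl, hlt⟩
    · simpa [potential, hP', List.getElem?_append] using Nat.lt_succ_of_le (I.rank_le B')
    · simpa [potential, hP', List.getElem?_append] using hlt

theorem exists_isFinal [Fintype M] (hσ : I.IsPartial D σ) (hnew : new ∉ D)
    (hext : ¬ ∃ τ, I.IsPartial (insert new D) τ) :
    ∃ σ L, I.IsPartial D σ ∧ I.Good new σ L ∧ I.IsFinal new σ L := by
  let N := Fintype.card (M × Bool)
  obtain ⟨⟨τ, L⟩, ⟨h1, h2⟩, hmin⟩ := WellFounded.has_min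
    (InvImage.wf (fun x : (J → Option M) × List (Blocker M J) => I.potential N x.1 x.2)
      (wellFounded_lt (α := Lex (Fin N → ℕ))))
    {x | I.IsPartial D x.1 ∧ I.Good new x.1 x.2} ⟨(σ, []), hσ, trivial⟩
  refine ⟨τ, L, h1, h2, ?_⟩
  by_contra hfin
  obtain ⟨σ', L', h3, h4, h5⟩ := exists_better h1 hnew hext h2 hfin
  exact hmin (σ', L') ⟨h3, h4⟩ (h5.potential_lt h4.length_le)

/-! ### Dual values and the constraints of the configurations -/

/-- The size of a job, capped at `5 / 6 * T`. -/
noncomputable def cappedSize (I : RestrictedInstance M J) (j : J) : ℝ :=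
  min (I.size j) (5 / 6 * I.T)

/-- The jobs with positive dual value: the movable and the locked ones. -/
def Active (I : RestrictedInstance M J) (new : J) (σ : J → Option M) (L : List (Blocker M J))
    (j : J) : Prop :=
  I.Movable new σ L j ∨ ∃ i, j ∈ I.locked σ L i

/-- The dual value of a job. -/
noncomputable def jobValue (I : RestrictedInstance M J) (new : J) (σ : J → Option M)
    (L : List (Blocker M J)) (j : J) : ℝ :=
  if I.Active new σ L j then I.cappedSize j else 0

omit [Fintype J] in
theorem cappedSize_nonneg (j : J) : 0 ≤ I.cappedSize j :=
  le_min (I.size_nonneg j) (mul_nonneg (by norm_num) I.T_nonneg)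

omit [Fintype J] in
theorem cappedSize_of_not_isBig (h : ¬ I.IsBig j) : I.cappedSize j = I.size j := by
  unfold IsBig at h
  have := I.T_nonneg
  exact min_eq_left (by linarith)

theorem jobValue_nonneg (j : J) : 0 ≤ I.jobValue new σ L j := by
  unfold jobValue
  split_ifs
  · exact cappedSize_nonneg j
  · exact le_rfl

theorem jobValue_le (j : J) : I.jobValue new σ L j ≤ I.cappedSize j := by
  unfold jobValue
  split_ifs
  · exact le_rfl
  · exact cappedSize_nonneg j

theorem sum_jobValue_le_of_active {s t : Finset J}
    (h : ∀ d ∈ s, I.Active new σ L d → d ∈ t) :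
    ∑ d ∈ s, I.jobValue new σ L d ≤ ∑ d ∈ t, I.jobValue new σ L d := by
  rw [← Finset.sum_filter_add_sum_filter_not s (I.Active new σ L),
    Finset.sum_eq_zero (s := s.filter fun d => ¬ I.Active new σ L d)
      (fun d hd => by simp [jobValue, (Finset.mem_filter.1 hd).2]), add_zero]
  refine Finset.sum_le_sum_of_subset_of_nonneg (fun d hd => ?_) fun d _ _ => jobValue_nonneg d
  rw [Finset.mem_filter] at hd
  exact h d hd.1 hd.2

theorem jobValue_of_mem_locked (h : j ∈ I.locked σ L i) : I.jobValue new σ L j = I.size j := by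
  have ha : I.Active new σ L j := Or.inr ⟨i, h⟩
  rw [jobValue, if_pos ha, cappedSize_of_not_isBig (mem_locked.1 h).2.1]

theorem lockedLoad_le (new : J) (σ : J → Option M) (L : List (Blocker M J)) (i : M) :
    I.lockedLoad σ L i ≤ ∑ d ∈ jobsOn σ i, I.jobValue new σ L d := by
  rw [lockedLoad, ← Finset.sum_congr rfl fun d hd => jobValue_of_mem_locked (new := new) hd]
  exact Finset.sum_le_sum_of_subset_of_nonneg
    (fun d hd => mem_jobsOn.2 (mem_locked.1 hd).1) fun d _ _ => jobValue_nonneg d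

theorem lockedLoad_add_le {b : J} (hb : b ∈ I.bigsOn σ i) :
    I.lockedLoad σ L i + I.jobValue new σ L b ≤ ∑ d ∈ jobsOn σ i, I.jobValue new σ L d := by
  have hbl : b ∉ I.locked σ L i := fun h => (mem_locked.1 h).2.1 (mem_bigsOn.1 hb).2
  rw [lockedLoad, ← Finset.sum_congr rfl fun d hd => jobValue_of_mem_locked (new := new) hd,
    add_comm, ← Finset.sum_insert hbl]
  refine Finset.sum_le_sum_of_subset_of_nonneg (fun d hd => ?_) fun d _ _ => jobValue_nonneg d
  rcases Finset.mem_insert.1 hd with rfl | hd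
  · exact mem_jobsOn.2 (mem_bigsOn.1 hb).1
  · exact mem_jobsOn.2 (mem_locked.1 hd).1

/-- In a final state, the dual constraint of a configuration holds for every machine without a
full blocker. -/
theorem IsFinal.sum_jobValue_le (hfin : I.IsFinal new σ L) (hL : I.Good new σ L)
    (hi : ¬ IsFull L i) {S : Finset J} (hS : ∀ d ∈ S, I.allowed i d)
    (hT : ∑ d ∈ S, I.size d ≤ I.T) :
    ∑ d ∈ S, I.jobValue new σ L d ≤ ∑ d ∈ jobsOn σ i, I.jobValue new σ L d := by
  have hlocked : ∀ d ∈ S, (∃ m, d ∈ I.locked σ L m) → σ d = some i := by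
    rintro d hd ⟨m, hm⟩
    rw [mem_locked] at hm
    rcases hm.2.2 i (hS d hd) with h | h
    · rw [hm.1, h]
    · exact absurd h hi
  have hsmall : ∀ d ∈ S, I.Active new σ L d → ¬ I.IsBig d → σ d = some i := by
    rintro d hd (h | h) hb
    · exact hfin.small d i h hb (hS d hd) hi
    · exact hlocked d hd h
  by_cases hex : ∃ d ∈ S, I.Active new σ L d ∧ σ d ≠ some i
  swap
  · push Not at hex
    exact sum_jobValue_le_of_active fun d hd ha => mem_jobsOn.2 (hex d hd ha)
  obtain ⟨d, hd, hda, hdi⟩ := hex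
  have hbig : I.IsBig d := by
    by_contra hb
    exact hdi (hsmall d hd hda hb)
  have hmov : I.Movable new σ L d := hda.resolve_right fun h => hdi (hlocked d hd h)
  rw [← Finset.add_sum_erase S _ hd] at hT ⊢
  have hrest : ∑ e ∈ S.erase d, I.jobValue new σ L e ≤ ∑ e ∈ S.erase d, I.size e :=
    Finset.sum_le_sum fun e _ => (jobValue_le e).trans (min_le_left _ _)
  have hdcap : I.jobValue new σ L d ≤ 5 / 6 * I.T := (jobValue_le d).trans (min_le_right _ _)
  by_cases huse : I.lockedLoad σ L i + I.size d ≤ 11 / 6 * I.T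
  swap
  -- The value of `S` is at most `5 / 6 * T + (T - size d)`, and the locked load alone exceeds this.
  · have := I.lockedLoad_le new σ L i
    linarith
  obtain ⟨C, hC, hl, rfl, hb⟩ := hfin.big d i hmov hbig (hS d hd) hi hdi huse
  obtain ⟨b, hbm, hbmin⟩ := (I.bigsOn σ C.mach).exists_min_image I.size (hL.nonempty_of_mem hC hl)
  have hbig_b := (mem_bigsOn.1 hbm).2
  have hbu : I.Undesirable σ C b := ⟨(mem_bigsOn.1 hbm).1, Or.inr ⟨hbig_b, hbmin⟩⟩
  have hbval : I.jobValue new σ L b = I.cappedSize b := if_pos (Or.inl (Or.inr ⟨C, hC, hbu⟩))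
  have hbj : b ∈ jobsOn σ C.mach := mem_jobsOn.2 hbu.1
  by_cases hle : I.cappedSize d ≤ I.cappedSize b
  -- Exchange `d` for `b`: two big jobs do not fit into one configuration, so the other active jobs
  -- of `S` are small and already on the machine.
  · rw [← Finset.add_sum_erase _ _ hbj, hbval]
    refine add_le_add ((jobValue_le d).trans hle) (sum_jobValue_le_of_active fun e he hea => ?_)
    have heS := Finset.mem_of_mem_erase he
    have hesmall : ¬ I.IsBig e := by
      intro hbe
      have := Finset.single_le_sum (f := I.size) (fun e _ => I.size_nonneg e) he
      unfold IsBig at hbe hbig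
      linarith
    refine Finset.mem_erase.2 ⟨fun h => hesmall (h ▸ hbig_b),
      mem_jobsOn.2 (hsmall e heS hea hesmall)⟩
  · have hlt : I.size b < I.size d := by
      by_contra h
      exact hle (min_le_min_right _ (not_lt.1 h))
    have hcap : I.cappedSize b = I.size b := by
      refine min_eq_left ?_
      by_contra h
      apply hle
      rw [cappedSize, cappedSize, min_eq_right (not_le.1 h).le]
      exact min_le_right _ _
    have h1 := hb b hbm hbu hlt
    have h2 := lockedLoad_add_le (new := new) (L := L) hbm
    rw [hbval, hcap] at h2
    linarith

/-! ### Surplus of the fully blocked machines -/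

omit [Fintype J] in
theorem min_sum_le_sum_min {s : Finset J} {f : J → ℝ} (hf : ∀ j ∈ s, 0 ≤ f j) {c : ℝ}
    (hc : 0 ≤ c) : min (∑ j ∈ s, f j) c ≤ ∑ j ∈ s, min (f j) c := by
  by_cases h : ∃ j ∈ s, c ≤ f j
  · obtain ⟨j, hj, hcj⟩ := h
    refine (min_le_right _ _).trans ?_
    refine le_trans ?_ (Finset.single_le_sum (fun k hk => le_min (hf k hk) hc) hj)
    exact le_min hcj le_rfl
  · push Not at h
    rw [Finset.sum_congr rfl fun j hj => min_eq_left (h j hj).le]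
    exact min_le_left _ _

theorem le_sum_cappedSize_of_small (hB : B.full = true) (hb : I.Blocks σ B)
    (hj : ¬ I.IsBig B.job) : 7 / 6 * I.T ≤ ∑ d ∈ jobsOn σ B.mach, I.cappedSize d := by
  have hload := hb hB
  have hT := I.T_nonneg
  unfold IsBig at hj
  unfold load at hload
  -- The load exceeds `11 / 6 * T - T / 2 = 4 / 3 * T`. A job of size at least `5 / 6 * T` counts `5
  -- / 6 * T` and leaves more than `T / 3` for the rest; without such a job nothing is capped.
  by_cases h : ∃ d ∈ jobsOn σ B.mach, 5 / 6 * I.T ≤ I.size d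
  · obtain ⟨d, hd, hdT⟩ := h
    have hle := I.size_le d
    rw [← Finset.add_sum_erase _ _ hd] at hload ⊢
    have h1 : I.cappedSize d = 5 / 6 * I.T := min_eq_right hdT
    have h2 := min_sum_le_sum_min (s := (jobsOn σ B.mach).erase d) (f := I.size)
      (fun e _ => I.size_nonneg e) (c := 5 / 6 * I.T) (by linarith)
    have h3 : 1 / 3 * I.T ≤ min (∑ e ∈ (jobsOn σ B.mach).erase d, I.size e) (5 / 6 * I.T) :=
      le_min (by linarith) (by linarith)
    unfold cappedSize at h1 ⊢
    linarith
  · push Not at h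
    rw [Finset.sum_congr rfl fun d hd => show I.cappedSize d = I.size d from
      min_eq_left (h d hd).le]
    linarith

theorem le_sum_cappedSize (hB : B.full = true) (hb : I.Blocks σ B) :
    5 / 6 * I.T ≤ ∑ d ∈ jobsOn σ B.mach, I.cappedSize d := by
  have hload := hb hB
  have hT := I.T_nonneg
  have hle := I.size_le B.job
  unfold load at hload
  refine le_trans (le_min ?_ le_rfl) (min_sum_le_sum_min (fun d _ => I.size_nonneg d)
    (by linarith))
  linarith

theorem le_sum_cappedSize_of_two_bigs (h : 1 < (I.bigsOn σ i).card) :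
    I.T ≤ ∑ d ∈ jobsOn σ i, I.cappedSize d := by
  obtain ⟨a, ha, b, hb, hab⟩ := Finset.one_lt_card.1 h
  have hhalf : ∀ d ∈ I.bigsOn σ i, I.T / 2 ≤ I.cappedSize d := fun d hd => by
    have := I.T_nonneg
    exact le_min (mem_bigsOn.1 hd).2.le (by linarith)
  have hsub : ({a, b} : Finset J) ⊆ jobsOn σ i := by
    intro d hd
    rcases Finset.mem_insert.1 hd with rfl | hd
    · exact mem_jobsOn.2 (mem_bigsOn.1 ha).1
    · rw [Finset.mem_singleton.1 hd]
      exact mem_jobsOn.2 (mem_bigsOn.1 hb).1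
  have := Finset.sum_le_sum_of_subset_of_nonneg hsub
    fun d _ _ => cappedSize_nonneg (I := I) d
  rw [Finset.sum_pair hab] at this
  linarith [hhalf a ha, hhalf b hb]

/-- The surplus of the machine of a full blocker. -/
noncomputable def surplus (I : RestrictedInstance M J) (σ : J → Option M) (i : M) : ℝ :=
  ∑ d ∈ jobsOn σ i, I.cappedSize d - I.T

/-- A deficient blocker is compensated by the full blocker of a small job that follows it. -/
theorem Good.le_sum_surplus (hL : I.Good new σ L) (hb : ∀ C ∈ L.head?, I.Blocks σ C) :
    (if ∃ C ∈ L.head?, I.Deficient σ C then - (I.T / 6) else 0) ≤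
      (L.map fun B => if B.full = true then I.surplus σ B.mach else 0).sum := by
  induction L with
  | nil => simp
  | cons B P ih =>
    have hT := I.T_nonneg
    have ih := ih hL.2.2 fun C hC => (hL.2.1 C hC).1
    have hBb := hb B rfl
    have hP : (∃ C ∈ P.head?, I.Deficient σ C) → B.full = true ∧ ¬ I.IsBig B.job :=
      fun ⟨C, hC, hd⟩ => (hL.2.1 C hC).2 hd
    have hhead : (∃ C ∈ (B :: P).head?, I.Deficient σ C) ↔ I.Deficient σ B := by simp
    simp only [hhead, List.map_cons, List.sum_cons]
    by_cases hf : B.full = true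
    · by_cases hbig : I.IsBig B.job
      · rw [if_neg fun h => (hP h).2 hbig] at ih
        by_cases hd : I.Deficient σ B
        · have := le_sum_cappedSize hf hBb
          rw [if_pos hd, if_pos hf, surplus]
          linarith
        · have := le_sum_cappedSize_of_two_bigs (not_le.1 fun h => hd ⟨hf, hbig, h⟩)
          rw [if_neg hd, if_pos hf, surplus]
          linarith
      · have := le_sum_cappedSize_of_small hf hBb hbig
        rw [if_neg fun h => hbig h.2.1, if_pos hf, surplus]
        split_ifs at ih <;> linarith
    · rw [if_neg fun h => hf (hP h).1] at ih
      rw [if_neg fun h => hf h.1, if_neg hf]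
      linarith

theorem Good.sum_isFull [Fintype M] (hL : I.Good new σ L) (g : M → ℝ) :
    ∑ i with IsFull L i, g i = (L.map fun B => if B.full = true then g B.mach else 0).sum := by
  induction L with
  | nil => simp [IsFull]
  | cons B P ih =>
    rw [List.map_cons, List.sum_cons, ← ih hL.2.2]
    by_cases hf : B.full = true
    · rw [if_pos hf, ← Finset.sum_insert (by simpa using hL.1.not_full)]
      congr 1
      ext m
      simp [isFull_cons, hf, eq_comm]
    · simp [isFull_cons, hf]

theorem jobValue_of_isFull (hi : IsFull L i) (hj : j ∈ jobsOn σ i) :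
    I.jobValue new σ L j = I.cappedSize j := by
  obtain ⟨B, hB, hf, rfl⟩ := hi
  exact if_pos (Or.inl (Or.inr ⟨B, hB, mem_jobsOn.1 hj, Or.inl hf⟩))

theorem sum_jobsOn_add_le [Fintype M] (hj : σ j = none) {f : J → ℝ} (hf : ∀ j, 0 ≤ f j) :
    f j + ∑ i, ∑ d ∈ jobsOn σ i, f d ≤ ∑ d, f d := by
  rw [← Finset.sum_biUnion, ← Finset.sum_insert]
  · exact Finset.sum_le_sum_of_subset_of_nonneg (Finset.subset_univ _) fun d _ _ => hf d
  · simp [mem_jobsOn, hj]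
  · intro a _ b _ hab
    refine Finset.disjoint_left.2 fun d hd hd' => hab ?_
    rw [mem_jobsOn] at hd hd'
    exact Option.some.inj (hd.symm.trans hd')

/-! ### Contradiction with duality -/

/-- The dual of the configuration-LP is bounded by `0`. -/
def DualBound [Fintype M] (I : RestrictedInstance M J) : Prop :=
  ∀ (y : M → ℝ) (z : J → ℝ), (∀ j, 0 ≤ z j) →
    (∀ i, ∀ S : Finset J, (∀ j ∈ S, I.allowed i j) → ∑ j ∈ S, I.size j ≤ I.T →
      ∑ j ∈ S, z j ≤ y i) → ∑ j, z j ≤ ∑ i, y i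

theorem not_isFinal [Fintype M] (hdual : I.DualBound) (hnew : σ new = none)
    (hpos : 0 < I.size new) (hL : I.Good new σ L) : ¬ I.IsFinal new σ L := by
  intro hfin
  have hT := I.T_nonneg
  have hTpos : 0 < I.T := hpos.trans_le (I.size_le new)
  have h := hdual (fun i => if IsFull L i then I.T else ∑ d ∈ jobsOn σ i, I.jobValue new σ L d)
    (I.jobValue new σ L) jobValue_nonneg (fun i S hS hle => by
      split_ifs with hi
      · exact (Finset.sum_le_sum fun d _ => (jobValue_le d).trans (min_le_left _ _)).trans hle
      · exact hfin.sum_jobValue_le hL hi hS hle)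
  have h1 := sum_jobsOn_add_le hnew (I.jobValue_nonneg (new := new) (σ := σ) (L := L))
  have h2 : 0 < I.jobValue new σ L new := by
    have ha : I.Active new σ L new := Or.inl (Or.inl rfl)
    rw [jobValue, if_pos ha]
    exact lt_min hpos (by linarith)
  have h3 := hL.le_sum_surplus fun C hC => (hfin.blocks C hC).1
  rw [if_neg fun ⟨C, hC, hd⟩ => (hfin.blocks C hC).2 hd, ← hL.sum_isFull] at h3
  have h4 : ∑ i with IsFull L i, I.surplus σ i =
      ∑ i, (∑ d ∈ jobsOn σ i, I.jobValue new σ L d -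
        if IsFull L i then I.T else ∑ d ∈ jobsOn σ i, I.jobValue new σ L d) := by
    rw [Finset.sum_filter]
    refine Finset.sum_congr rfl fun i _ => ?_
    split_ifs with hi
    · rw [surplus, Finset.sum_congr rfl fun d hd => jobValue_of_isFull hi hd]
    · rw [sub_self]
  rw [h4, Finset.sum_sub_distrib] at h3
  linarith

/-- Otherwise value `1` on `j` alone at machine cost `0` would violate the bound. -/
theorem DualBound.exists_allowed [Fintype M] (hdual : I.DualBound) (j : J) :
    ∃ i, I.allowed i j := by
  by_contra! hno
  have := hdual 0 (Pi.single j 1) (fun d => by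
    by_cases h : d = j
    · subst h; simp
    · simp [h]) (fun i S hS _ => by
    refine (Finset.sum_eq_zero fun d hd => ?_).le
    refine Pi.single_eq_of_ne ?_ _
    rintro rfl
    exact hno i (hS _ hd))
  simp at this
  linarith

theorem DualBound.exists_isPartial [Fintype M] (hdual : I.DualBound) (D : Finset J) :
    ∃ σ, I.IsPartial D σ := by
  induction D using Finset.induction_on with
  | empty =>
    refine ⟨fun _ => none, by simp, by simp, fun i => ?_⟩
    have : jobsOn (fun _ : J => (none : Option M)) i = ∅ :=
      Finset.eq_empty_of_forall_notMem fun d hd => by simp [mem_jobsOn] at hd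
    rw [load, this, Finset.sum_empty]
    exact mul_nonneg (by norm_num) I.T_nonneg
  | insert new D hnew ih =>
    obtain ⟨σ, hσ⟩ := ih
    have hnone := (hσ.eq_none_iff new).2 hnew
    -- The dual argument needs `new` to have positive value; a job of size `0` fits on any allowed
    -- machine.
    rcases (I.size_nonneg new).eq_or_lt with hzero | hpos
    · obtain ⟨i, hi⟩ := hdual.exists_allowed new
      exact ⟨_, hσ.update (by linarith [hσ.load_le i]) (by simp [hnone]) hi⟩
    · by_contra hext
      obtain ⟨τ, L, h1, h2, h3⟩ := exists_isFinal hσ hnew hext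
      exact not_isFinal hdual ((h1.eq_none_iff new).2 hnew) hpos h2 h3

end RestrictedInstance

/-! ### Weak duality and the return to the original instance -/

open Classical in
theorem IsLPSolution.sum_le_sum {M : Type u} {J : Type v} [Fintype M] [Fintype J]
    {p : M → J → ℝ≥0∞} {T : ℝ≥0} {x : M → Finset J → ℝ} (hx : IsLPSolution p T x)
    {y : M → ℝ} {z : J → ℝ} (hz : ∀ j, 0 ≤ z j)
    (h : ∀ i, ∀ C ∈ configs p T i, ∑ j ∈ C, z j ≤ y i) : ∑ j, z j ≤ ∑ i, y i := by
  -- The empty configuration gives the sign of `y i`, needed because the machine constraints are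
  -- inequalities.
  have hy : ∀ i, 0 ≤ y i := fun i => by simpa using h i ∅ (by simp [configs])
  calc ∑ j, z j ≤ ∑ j, z j * ∑ i, ∑ C ∈ configs p T i with j ∈ C, x i C :=
        Finset.sum_le_sum fun j _ => le_mul_of_one_le_right (hz j) (hx.job j)
    _ = ∑ i, ∑ C ∈ configs p T i, x i C * ∑ j ∈ C, z j := by
        simp only [Finset.mul_sum, Finset.sum_filter]
        rw [Finset.sum_comm]
        refine Finset.sum_congr rfl fun i _ => ?_
        rw [Finset.sum_comm]
        refine Finset.sum_congr rfl fun C _ => ?_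
        rw [← Finset.sum_filter_add_sum_filter_not Finset.univ (· ∈ C)]
        rw [Finset.sum_eq_zero (s := Finset.univ.filter (· ∉ C))
          fun j hj => by simp [(Finset.mem_filter.1 hj).2]]
        rw [add_zero, Finset.filter_univ_mem]
        exact Finset.sum_congr rfl fun j hj => by simp [hj, mul_comm]
    _ ≤ ∑ i, ∑ C ∈ configs p T i, x i C * y i :=
        Finset.sum_le_sum fun i _ => Finset.sum_le_sum fun C hC =>
          mul_le_mul_of_nonneg_left (h i C hC) (hx.nonneg i C hC)
    _ ≤ ∑ i, y i := Finset.sum_le_sum fun i _ => by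
        rw [← Finset.sum_mul]
        exact mul_le_of_le_one_left (hy i) (hx.machine i)

theorem IsLPSolution.exists_le {M : Type u} {J : Type v} [Fintype M] [Fintype J]
    {p : M → J → ℝ≥0∞} {T : ℝ≥0} {x : M → Finset J → ℝ} (hx : IsLPSolution p T x) (j : J) :
    ∃ i, p i j ≤ T := by
  classical
  by_contra! hno
  have hj := hx.job j
  rw [Finset.sum_eq_zero fun i _ => ?_] at hj
  · linarith
  · refine Finset.sum_eq_zero fun C hC => ?_
    obtain ⟨hC, hjC⟩ := Finset.mem_filter.1 hC
    have hC' : ∑ j ∈ C, p i j ≤ T := by simpa [configs] using hC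
    exact absurd ((Finset.single_le_sum (fun _ _ => zero_le) hjC).trans hC') (not_le.2 (hno i))

/-- A feasible configuration-LP yields a solution whose makespan exceeds the target at most by the
factor `11 / 6`. -/
theorem exists_makespan_le {M : Type u} {J : Type v} [Fintype M] [Fintype J] {p : M → J → ℝ≥0∞}
    (hp : IsRestrictedAssignment p) {T : ℝ≥0} (hT : LPFeasible p T) :
    ∃ σ : J → M, makespan p σ ≤ 11 / 6 * (T : ℝ≥0∞) := by
  classical
  obtain ⟨s, hs⟩ := hp
  obtain ⟨x, hx⟩ := hT
  have heq : ∀ i j, p i j ≠ ∞ → p i j = s j := fun i j h => (hs i j).resolve_right h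
  let I : RestrictedInstance M J :=
    { size := fun j => s j
      allowed := fun i j => p i j ≠ ∞
      T := T
      T_nonneg := T.2
      size_nonneg := fun j => (s j).2
      size_le := fun j => by
        obtain ⟨i, hi⟩ := hx.exists_le j
        rw [heq i j (hi.trans_lt ENNReal.coe_lt_top).ne] at hi
        exact_mod_cast hi }
  have hdual : I.DualBound := by
    intro y z hz h
    refine hx.sum_le_sum hz fun i C hC => ?_
    have hC' : ∑ j ∈ C, p i j ≤ T := by simpa [configs] using hC
    have hfin : ∀ j ∈ C, p i j ≠ ∞ := fun j hj =>
      (((Finset.single_le_sum (fun _ _ => zero_le) hj).trans hC').trans_lt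
        ENNReal.coe_lt_top).ne
    refine h i C hfin ?_
    rw [Finset.sum_congr rfl fun j hj => heq i j (hfin j hj)] at hC'
    change ∑ j ∈ C, (s j : ℝ) ≤ (T : ℝ)
    exact_mod_cast hC'
  obtain ⟨τ, hτ⟩ := hdual.exists_isPartial Finset.univ
  have hsome : ∀ j, ∃ i, τ j = some i := fun j =>
    Option.ne_none_iff_exists'.1 fun h => (hτ.eq_none_iff j).1 h (Finset.mem_univ j)
  choose σ hσ using hsome
  refine ⟨σ, iSup_le fun i => ?_⟩
  have hload : ∑ j with σ j = i, (s j : ℝ) ≤ 11 / 6 * (T : ℝ) := by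
    have hjobs : jobsOn τ i = Finset.univ.filter fun j => σ j = i := by
      ext j
      simp [mem_jobsOn, hσ]
    have := hτ.load_le i
    rwa [RestrictedInstance.load, hjobs] at this
  have hload' : ∑ j with σ j = i, s j ≤ 11 / 6 * T := by exact_mod_cast hload
  have hcoe : ((11 / 6 * T : ℝ≥0) : ℝ≥0∞) = 11 / 6 * (T : ℝ≥0∞) := by
    rw [ENNReal.coe_mul, ENNReal.coe_div (by norm_num)]
    rfl
  have hsum : ∑ j with σ j = i, p i j = ((∑ j with σ j = i, s j : ℝ≥0) : ℝ≥0∞) := by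
    rw [ENNReal.ofNNReal_finsetSum]
    refine Finset.sum_congr rfl fun j hj => heq i j ?_
    rw [← (Finset.mem_filter.1 hj).2]
    exact hτ.allowed j _ (hσ j)
  rw [← ENNReal.coe_le_coe, hcoe, ← hsum] at hload'
  convert hload'

theorem opt_div_lpOpt_le {M : Type u} {J : Type v} [Fintype M] [Fintype J] {p : M → J → ℝ≥0∞}
    (hp : IsRestrictedAssignment p) : opt p / lpOpt p ≤ 11 / 6 := by
  have h0 : (11 / 6 : ℝ≥0∞) ≠ 0 := by simp
  have htop : (11 / 6 : ℝ≥0∞) ≠ ∞ := ENNReal.div_ne_top (by simp) (by simp)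
  refine ENNReal.div_le_of_le_mul ?_
  -- With the factor on the left, it suffices to compare with each feasible `T`; the infimum need
  -- not be attained.
  rw [mul_comm, ← ENNReal.div_le_iff h0 htop]
  refine le_iInf₂ fun T hT => ?_
  rw [ENNReal.div_le_iff h0 htop, mul_comm]
  obtain ⟨σ, hσ⟩ := exists_makespan_le hp hT
  exact (iInf_le _ σ).trans hσ

end Scheduling

theorem theorem1 :
    Scheduling.integralityGap.{u, v} ≤ 11 / 6 ∧
    ∀ (M : Type u) (J : Type v) [Fintype M] [Fintype J] (p : M → J → ℝ≥0∞),
      Scheduling.IsRestrictedAssignment p →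
      ∀ T : ℝ≥0, Scheduling.LPFeasible p T →
        ∃ σ : J → M, Scheduling.makespan p σ ≤ 11 / 6 * (T : ℝ≥0∞) := by
  refine ⟨?_, fun M J _ _ p hp T hT => Scheduling.exists_makespan_le hp hT⟩
  exact iSup_le fun M => iSup_le fun J => iSup_le fun _ => iSup_le fun _ => iSup_le fun p =>
    iSup_le fun hp => Scheduling.opt_div_lpOpt_le hp
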